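/- **Model.** There are $k$ sites and a coordinator. Time proceeds in synchronous rounds: in each round each site observes at most one element (or none) and may send a message to the coordinator, after which the coordinator may send a message to each site. A site's message depends on its random bits, on its past observations and received messages, and on its present observation; the coordinator's messages and its sample depend on its random bits and on all messages received so far. All nodes may use internal randomness; message length, memory and computation are unrestricted. The elements of the union of the streams are pairwise distinct; their number, order of arrival, and distribution over sites and rounds are arbitrary. A protocol is *correct* for sample size $s$ if, on every input and at the end of every round, the coordinator holds a uniformly random subset, of size $\min\{m,s\}$, of the set of the $m$ elements observed so far (a uniform sample without replacement). The cost is the number of messages transmitted, in both directions. **Theorem.** For every constant $0<q<1$ there is a constant $C=C(q)>0$ such that for all integers $k\ge 1$, $s\ge 1$ and $n\ge k$ (and every universe with at least $n$ elements) there is a probability distribution on inputs with exactly $n$ elements, which depends on $q,k,s,n$ and the universe but not on the protocol, such that every correct protocol for $k$ sites and sample size $s$, run on an input drawn from it, 1. transmits at least $C\,\dfrac{k\log(n/s)}{\log(1+k/s)}$ messages with probability at least $1-q$, over the input and the protocol's internal randomness, and 2. transmits at least $C\,\dfrac{k\log(n/s)}{\log(1+k/s)}$ messages in expectation. Moreover,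 for every correct protocol there is a fixed input in the support of this distribution on which both bounds hold over the protocol's internal randomness alone. -/

import Mathlib

open MeasureTheory
open scoped ENNReal

namespace DistributedSampling

/-- An arrival pattern for `k` sites: `x r j` is the element observed by site `j` in round `r`
(`none` if it observes nothing in that round). Rounds are numbered from `0`. -/
abbrev Input (k : ℕ) (α : Type*) : Type _ := ℕ → Fin k → Option α

/-- The elements of the union of the streams are pairwise distinct. -/
def Input.Distinct {k : ℕ} {α : Type*} (x : Input k α) : Prop :=
  ∀ r j r' j' a, x r j = some a → x r' j' = some a → r = r' ∧ j = j'

open Classical in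
/-- The set of all elements observed by the sites in the first `T` rounds. -/
noncomputable def Input.arrived {k : ℕ} {α : Type*} (x : Input k α) (T : ℕ) : Finset α :=
  (Finset.range T).biUnion fun r => Finset.univ.biUnion fun j => (x r j).toFinset

/-- A randomized protocol between `k` sites and a coordinator in the synchronous round model.
`ω : Ω` is the concatenation of the random strings of all the nodes; `U` and `D` are the types of
messages to and from the coordinator. No bound is put on the size of a message, on memory, or on
local computation.

In each round every site may observe an element and may send a message, which depends on its
random string, on the past rounds as seen by this site (its observation and the message that it
got from the coordinator, for each past round, oldest first) and on its present observation. The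
coordinator, knowing all the messages received so far, those of the present round included
(oldest round first), may then send a message to each of the sites, and outputs its sample.
`none` stands for no message. -/
structure Protocol (k : ℕ) (α Ω U D : Type*) where
  site : Fin k → Ω → List (Option α × Option D) → Option α → Option U
  coord : Ω → List (Fin k → Option U) → Fin k → Option D
  sample : Ω → List (Fin k → Option U) → Finset α

namespace Protocol

variable {k : ℕ} {α Ω U D : Type*}

/-- The local histories of the sites and the history of the coordinator after the first `r`
rounds. -/
def run (P : Protocol k α Ω U D) (ω : Ω) (x : Input k α) :
    ℕ → (Fin k → List (Option α × Option D)) × List (Fin k → Option U)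
  | 0 => (fun _ => [], [])
  | r + 1 =>
    let h := P.run ω x r
    let c := h.2 ++ [fun j => P.site j ω (h.1 j) (x r j)]
    (fun j => h.1 j ++ [(x r j, P.coord ω c j)], c)

/-- The message sent by site `j` to the coordinator in round `r`. -/
def up (P : Protocol k α Ω U D) (ω : Ω) (x : Input k α) (r : ℕ) (j : Fin k) : Option U :=
  P.site j ω ((P.run ω x r).1 j) (x r j)

/-- The message sent by the coordinator to site `j` in round `r`. -/
def down (P : Protocol k α Ω U D) (ω : Ω) (x : Input k α) (r : ℕ) (j : Fin k) : Option D :=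
  P.coord ω (P.run ω x (r + 1)).2 j

/-- The sample held by the coordinator at the end of round `r`. -/
def sampleAt (P : Protocol k α Ω U D) (ω : Ω) (x : Input k α) (r : ℕ) : Finset α :=
  P.sample ω (P.run ω x (r + 1)).2

/-- The number of messages transmitted, in both directions, in the first `T` rounds. -/
def messages (P : Protocol k α Ω U D) (ω : Ω) (x : Input k α) (T : ℕ) : ℕ :=
  ∑ r ∈ Finset.range T, ∑ j : Fin k,
    ((if (P.up ω x r j).isSome then 1 else 0) + (if (P.down ω x r j).isSome then 1 else 0))

/-- On every input, whether a message is sent over a given link in a given round, and which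
sample is held, are random variables. -/
structure IsMeasurable [MeasurableSpace Ω] (P : Protocol k α Ω U D) : Prop where
  up : ∀ x r j, MeasurableSet {ω | (P.up ω x r j).isSome}
  down : ∀ x r j, MeasurableSet {ω | (P.down ω x r j).isSome}
  sample : ∀ x r A, MeasurableSet {ω | P.sampleAt ω x r = A}

end Protocol

/-- The random set `X` is a uniform sample without replacement, of size `min (#S) s`, from `S`:
each subset of `S` of this size is taken with the same probability, and these probabilities sum
to one. -/
def IsUniformSample {α Ω : Type*} [MeasurableSpace Ω] (μ : Measure Ω) (X : Ω → Finset α)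
    (S : Finset α) (s : ℕ) : Prop :=
  ∀ A : Finset α, A ⊆ S → A.card = min S.card s →
    μ {ω | X ω = A} = ((S.card.choose (min S.card s) : ℕ) : ℝ≥0∞)⁻¹

/-- The protocol is correct for sample size `s`: on every input, at the end of every round, the
coordinator holds a uniform sample without replacement of the elements observed so far. -/
def Protocol.Correct {k : ℕ} {α Ω U D : Type*} [MeasurableSpace Ω] (P : Protocol k α Ω U D)
    (μ : Measure Ω) (s : ℕ) : Prop :=
  ∀ x : Input k α, x.Distinct → ∀ r : ℕ,
    IsUniformSample μ (fun ω => P.sampleAt ω x r) (x.arrived (r + 1)) s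

/-- The quantity `k log (n/s) / log (1 + k/s)`, with logarithms to the base `2`. -/
noncomputable def bound (k s n : ℕ) : ℝ :=
  (k : ℝ) * Real.logb 2 ((n : ℝ) / s) / Real.logb 2 (1 + (k : ℝ) / s)

end DistributedSampling

/-!
The random input is divided into stages. A stage consists of many slots, and all its elements arrive
in a single slot, chosen uniformly at random. A pair of a stage and a site is hard if, supposing
that nothing else arrives in the stage, the elements observed by the site in the stage are numerous
enough that the sample has to change with high probability.

Such a pair costs a message. Stop the input before the stage, and call this the prefix. Whatever
happens on the prefix does not depend on the slot, and a protocol that transmits fewer than `B`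
messages altogether transmits messages in fewer than `B` of the slots, so the chosen slot is most
likely one in which the protocol is silent on the prefix. If in addition the link of the site is
silent in this slot on the random input, then the coordinator cannot tell the prefix from the prefix
continued at this site alone, and it holds the same sample on both inputs. By hardness this is
unlikely. Hence, by Markov's inequality, at least half of the `K` hard pairs are likely to have
links that are not silent, unless there are `K` messages anyway.

It remains to find `n` elements with many hard pairs. The first `s` elements make one hard pair
each. After that, all `k` pairs of a stage are hard once every site observes more than `A / s` times
the number of elements that have arrived before. A stage then multiplies the number of elements by
at most `1 + (A + 1) k / s ≤ (1 + k / s) ^ (A + 1)`, and there are about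
`log (n / s) / log (1 + k / s)` stages.
-/

namespace DistributedSampling

open scoped Finset BigOperators

namespace Input

variable {k : ℕ} {α : Type*}

/-- The input that consists of the rounds of `x` before round `t`, after which nothing arrives. -/
def truncate (x : Input k α) (t : ℕ) : Input k α :=
  fun r i => if r < t then x r i else none

/-- The input that consists of the rounds of `x` before round `t`, from which on only site `j` goes
on observing its stream of `x`. -/
def isolate (x : Input k α) (j : Fin k) (t : ℕ) : Input k α :=
  fun r i => if r < t ∨ i = j then x r i else none

theorem truncate_of_lt {x : Input k α} {t r : ℕ} (hr : r < t) : x.truncate t r = x r := by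
  funext i
  simp only [truncate, if_pos hr]

theorem isolate_of_lt {x : Input k α} {j : Fin k} {t r : ℕ} (hr : r < t) :
    x.isolate j t r = x r := by
  funext i
  simp only [isolate, hr, true_or, if_true]

theorem truncate_eq_some_iff {x : Input k α} {t r : ℕ} {i : Fin k} {a : α} :
    x.truncate t r i = some a ↔ r < t ∧ x r i = some a := by
  simp [truncate]

theorem isolate_eq_some_iff {x : Input k α} {j : Fin k} {t r : ℕ} {i : Fin k} {a : α} :
    x.isolate j t r i = some a ↔ (r < t ∨ i = j) ∧ x r i = some a := by
  simp [isolate]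

theorem Distinct.mono {x y : Input k α} (hy : y.Distinct)
    (hxy : ∀ r j a, x r j = some a → y r j = some a) : x.Distinct :=
  fun r j r' j' a h h' => hy r j r' j' a (hxy r j a h) (hxy r' j' a h')

theorem Distinct.truncate {x : Input k α} (hx : x.Distinct) (t : ℕ) : (x.truncate t).Distinct :=
  hx.mono fun _ _ _ h => (truncate_eq_some_iff.1 h).2

theorem Distinct.isolate {x : Input k α} (hx : x.Distinct) (j : Fin k) (t : ℕ) :
    (x.isolate j t).Distinct :=
  hx.mono fun _ _ _ h => (isolate_eq_some_iff.1 h).2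

theorem mem_arrived {x : Input k α} {T : ℕ} {a : α} :
    a ∈ x.arrived T ↔ ∃ r < T, ∃ j, x r j = some a := by
  simp [arrived]

theorem arrived_truncate (x : Input k α) {t T : ℕ} (htT : t ≤ T) :
    (x.truncate t).arrived T = x.arrived t := by
  ext a
  simp only [mem_arrived, truncate_eq_some_iff]
  exact ⟨fun ⟨r, _, j, hr, h⟩ => ⟨r, hr, j, h⟩, fun ⟨r, hr, j, h⟩ => ⟨r, hr.trans_le htT, j, hr, h⟩⟩

theorem arrived_subset_arrived_isolate (x : Input k α) (j : Fin k) {t T : ℕ} (htT : t ≤ T) :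
    x.arrived t ⊆ (x.isolate j t).arrived T := fun a ha => by
  obtain ⟨r, hr, i, h⟩ := mem_arrived.1 ha
  exact mem_arrived.2 ⟨r, hr.trans_le htT, i, isolate_eq_some_iff.2 ⟨Or.inl hr, h⟩⟩

end Input

namespace Protocol

variable {k : ℕ} {α Ω U D : Type*} {P : Protocol k α Ω U D} {ω : Ω} {x y z : Input k α}

theorem run_succ_fst (P : Protocol k α Ω U D) (ω : Ω) (x : Input k α) (r : ℕ) (j : Fin k) :
    (P.run ω x (r + 1)).1 j = (P.run ω x r).1 j ++ [(x r j, P.down ω x r j)] := rfl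

theorem run_succ_snd (P : Protocol k α Ω U D) (ω : Ω) (x : Input k α) (r : ℕ) :
    (P.run ω x (r + 1)).2 = (P.run ω x r).2 ++ [P.up ω x r] := rfl

theorem run_congr {R : ℕ} (hxy : ∀ r < R, x r = y r) : P.run ω x R = P.run ω y R := by
  induction R with
  | zero => rfl
  | succ R ih => simp only [run, ih fun r hr => hxy r (by lia), hxy R (by lia)]

theorem messages_congr {T : ℕ} (hxy : ∀ r < T, x r = y r) :
    P.messages ω x T = P.messages ω y T := by
  refine Finset.sum_congr rfl fun r hr => ?_
  rw [Finset.mem_range] at hr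
  have hrun : ∀ r' ≤ T, P.run ω x r' = P.run ω y r' := fun r' hr' =>
    run_congr fun r'' hr'' => hxy r'' (hr''.trans_le hr')
  have hup : P.up ω x r = P.up ω y r := by
    funext j
    rw [up, up, hrun r hr.le, hxy r hr]
  have hdown : P.down ω x r = P.down ω y r := by
    funext j
    rw [down, down, hrun (r + 1) hr]
  rw [hup, hdown]

theorem messages_mono (P : Protocol k α Ω U D) (ω : Ω) (x : Input k α) :
    Monotone (P.messages ω x) :=
  fun _ _ h => Finset.sum_le_sum_of_subset (Finset.range_mono h)

theorem IsMeasurable.messages [MeasurableSpace Ω] (hP : P.IsMeasurable) (x : Input k α) (T : ℕ) :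
    Measurable fun ω => P.messages ω x T :=
  Finset.measurable_sum _ fun r _ => Finset.measurable_sum _ fun j _ =>
    (Measurable.ite (hP.up x r j) measurable_const measurable_const).add
      (Measurable.ite (hP.down x r j) measurable_const measurable_const)

/-- No message is transmitted, in either direction, between site `j` and the coordinator during the
rounds in `W`. -/
def LinkSilent (P : Protocol k α Ω U D) (ω : Ω) (x : Input k α) (j : Fin k) (W : Finset ℕ) :
    Prop :=
  ∀ r ∈ W, P.up ω x r j = none ∧ P.down ω x r j = none

theorem IsMeasurable.linkSilent [MeasurableSpace Ω] (hP : P.IsMeasurable) (x : Input k α)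
    (j : Fin k) (W : Finset ℕ) : MeasurableSet {ω | P.LinkSilent ω x j W} := by
  have hW : {ω | P.LinkSilent ω x j W} =
      ⋂ r ∈ W, {ω | (P.up ω x r j).isSome}ᶜ ∩ {ω | (P.down ω x r j).isSome}ᶜ := by
    ext ω
    simp [LinkSilent]
  rw [hW]
  exact W.measurableSet_biInter fun r _ => (hP.up x r j).compl.inter (hP.down x r j).compl

/-- The number of messages transmitted in round `r` between site `j` and the coordinator. -/
def linkMessages (P : Protocol k α Ω U D) (ω : Ω) (x : Input k α) (r : ℕ) (j : Fin k) : ℕ :=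
  (if (P.up ω x r j).isSome then 1 else 0) + (if (P.down ω x r j).isSome then 1 else 0)

theorem messages_eq_sum_linkMessages (P : Protocol k α Ω U D) (ω : Ω) (x : Input k α) (T : ℕ) :
    P.messages ω x T = ∑ r ∈ Finset.range T, ∑ j, P.linkMessages ω x r j := rfl

theorem linkSilent_iff_sum_linkMessages_eq_zero {j : Fin k} {W : Finset ℕ} :
    P.LinkSilent ω x j W ↔ ∑ r ∈ W, P.linkMessages ω x r j = 0 := by
  simp [LinkSilent, linkMessages]

open Classical in
theorem card_not_linkSilent_le_messages {ι : Type*} [Fintype ι] {W : ι → Finset ℕ} {T : ℕ}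
    (hW : Pairwise (Function.onFun Disjoint W)) (hWT : ∀ i, W i ⊆ Finset.range T) :
    #{p : ι × Fin k | ¬ P.LinkSilent ω x p.2 (W p.1)} ≤ P.messages ω x T :=
  calc
    _ = ∑ p : ι × Fin k, if ¬ P.LinkSilent ω x p.2 (W p.1) then 1 else 0 :=
      Finset.card_filter ..
    _ ≤ ∑ p : ι × Fin k, ∑ r ∈ W p.1, P.linkMessages ω x r p.2 := by
      refine Finset.sum_le_sum fun p _ => ?_
      split_ifs with hp
      · exact Nat.zero_le _
      · exact Nat.one_le_iff_ne_zero.2 (linkSilent_iff_sum_linkMessages_eq_zero.not.1 hp)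
    _ = ∑ r ∈ Finset.univ.biUnion W, ∑ j, P.linkMessages ω x r j := by
      simp only [Finset.sum_biUnion fun _ _ _ _ h => hW h, Fintype.sum_prod_type]
      exact Finset.sum_congr rfl fun i _ => Finset.sum_comm
    _ ≤ P.messages ω x T := by
      rw [messages_eq_sum_linkMessages]
      exact Finset.sum_le_sum_of_subset (Finset.biUnion_subset.2 fun i _ => hWT i)

theorem linkSilent_Ico_of_messages_eq {t R : ℕ} (h : P.messages ω x t = P.messages ω x R)
    (j : Fin k) : P.LinkSilent ω x j (Finset.Ico t R) := by
  rcases le_total R t with hRt | htR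
  · simp [LinkSilent, Finset.Ico_eq_empty_of_le hRt]
  have hzero : ∑ r ∈ Finset.Ico t R, ∑ i, P.linkMessages ω x r i = 0 := by
    rw [messages_eq_sum_linkMessages, messages_eq_sum_linkMessages,
      ← Finset.sum_range_add_sum_Ico _ htR] at h
    lia
  rw [linkSilent_iff_sum_linkMessages_eq_zero, Finset.sum_eq_zero_iff]
  exact fun r hr => Finset.sum_eq_zero_iff.1 (Finset.sum_eq_zero_iff.1 hzero r hr) j
    (Finset.mem_univ j)

theorem run_isolate_of_linkSilent {t R : ℕ} {j : Fin k} (htR : t ≤ R)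
    (hx : P.LinkSilent ω x j (Finset.Ico t R))
    (hx₀ : ∀ i, P.LinkSilent ω (x.truncate t) i (Finset.Ico t R)) :
    (P.run ω (x.isolate j t) R).2 = (P.run ω (x.truncate t) R).2 ∧
      (P.run ω (x.isolate j t) R).1 j = (P.run ω x R).1 j ∧
      ∀ i ≠ j, (P.run ω (x.isolate j t) R).1 i = (P.run ω (x.truncate t) R).1 i := by
  induction R, htR using Nat.le_induction with
  | base =>
    rw [run_congr fun r hr => Input.isolate_of_lt (x := x) (j := j) hr,
      run_congr fun r hr => Input.truncate_of_lt (x := x) hr]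
    exact ⟨rfl, rfl, fun _ _ => rfl⟩
  | succ R htR ih =>
    have hsub : Finset.Ico t R ⊆ Finset.Ico t (R + 1) := Finset.Ico_subset_Ico_right R.le_succ
    have hR : R ∈ Finset.Ico t (R + 1) := Finset.mem_Ico.2 ⟨htR, R.lt_succ_self⟩
    obtain ⟨hcoord, hsite, hother⟩ := ih (fun r hr => hx r (hsub hr)) fun i r hr =>
      hx₀ i r (hsub hr)
    have hobs : x.isolate j t R j = x R j := by simp [Input.isolate]
    have hobs' : ∀ i ≠ j, x.isolate j t R i = x.truncate t R i := fun i hi => by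
      simp [Input.isolate, Input.truncate, hi]
    have hup : P.up ω (x.isolate j t) R = P.up ω (x.truncate t) R := by
      funext i
      rcases eq_or_ne i j with rfl | hi
      · rw [(hx₀ i R hR).1, ← (hx R hR).1, up, up, hsite, hobs]
      · rw [up, up, hother i hi, hobs' i hi]
    have hcoord' : (P.run ω (x.isolate j t) (R + 1)).2 = (P.run ω (x.truncate t) (R + 1)).2 := by
      rw [run_succ_snd, run_succ_snd, hcoord, hup]
    have hdown : P.down ω (x.isolate j t) R = P.down ω (x.truncate t) R := by
      funext i
      rw [down, down, hcoord']
    refine ⟨hcoord', ?_, fun i hi => ?_⟩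
    · rw [run_succ_fst, run_succ_fst, hsite, hobs, hdown, (hx₀ j R hR).2, (hx R hR).2]
    · rw [run_succ_fst, run_succ_fst, hother i hi, hobs' i hi, hdown]

end Protocol

section Sample

variable {α Ω : Type*} [MeasurableSpace Ω] {μ : Measure Ω} [IsProbabilityMeasure μ]
  {X Y : Ω → Finset α} {S S' : Finset α} {s : ℕ}

/-- The probability that a uniform sample without replacement, of size `min M s`, from a set of `M`
elements lies in a given subset with `m` elements. -/
noncomputable def subsetProb (s m M : ℕ) : ℝ :=
  m.choose (min M s) / M.choose (min M s)

theorem subsetProb_le_iff {m M : ℕ} {δ : ℝ} :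
    subsetProb s m M ≤ δ ↔ (m.choose (min M s) : ℝ) ≤ δ * M.choose (min M s) :=
  div_le_iff₀ (by exact_mod_cast Nat.choose_pos (min_le_left M s))

theorem IsUniformSample.ae_mem_powersetCard (hX : IsUniformSample μ X S s)
    (hmX : ∀ A, MeasurableSet {ω | X ω = A}) : ∀ᵐ ω ∂μ, X ω ∈ S.powersetCard (min #S s) := by
  have hunion : {ω | X ω ∈ S.powersetCard (min #S s)} =
      ⋃ A ∈ S.powersetCard (min #S s), {ω | X ω = A} := by
    ext ω
    simp
  have hdisjoint : Set.PairwiseDisjoint (S.powersetCard (min #S s) : Set (Finset α))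
      fun A => {ω | X ω = A} := fun _ _ _ _ hAB =>
    Set.disjoint_left.2 fun ω hA hB => hAB (hA.symm.trans hB)
  have hmeas : MeasurableSet {ω | X ω ∈ S.powersetCard (min #S s)} :=
    hunion ▸ Finset.measurableSet_biUnion _ fun _ _ => hmX _
  refine (mem_ae_iff_prob_eq_one hmeas).2 ?_
  rw [hunion, measure_biUnion_finset hdisjoint fun A _ => hmX A]
  calc ∑ A ∈ S.powersetCard (min #S s), μ {ω | X ω = A}
      = ∑ _A ∈ S.powersetCard (min #S s), ((#S).choose (min #S s) : ℝ≥0∞)⁻¹ :=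
        Finset.sum_congr rfl fun _ hA => hX _ (Finset.mem_powersetCard.1 hA).1
          (Finset.mem_powersetCard.1 hA).2
    _ = 1 := by
        rw [Finset.sum_const, Finset.card_powersetCard, nsmul_eq_mul]
        refine ENNReal.mul_inv_cancel ?_ (ENNReal.natCast_ne_top _)
        exact_mod_cast (Nat.choose_pos (min_le_left _ _)).ne'

theorem IsUniformSample.measureReal_eq_le (hX : IsUniformSample μ X S s)
    (hY : IsUniformSample μ Y S' s) (hSS' : S ⊆ S')
    (hmX : ∀ A, MeasurableSet {ω | X ω = A}) (hmY : ∀ A, MeasurableSet {ω | Y ω = A}) :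
    μ.real {ω | Y ω = X ω} ≤ subsetProb s #S #S' := by
  have hsub : ∀ᵐ ω ∂μ, ω ∈ {ω | Y ω = X ω} →
      ω ∈ ⋃ A ∈ S.powersetCard (min #S' s), {ω | Y ω = A} := by
    filter_upwards [hX.ae_mem_powersetCard hmX, hY.ae_mem_powersetCard hmY] with ω hXω hYω hω
    rw [Finset.mem_powersetCard] at hXω hYω
    exact Set.mem_biUnion
      (Finset.mem_powersetCard.2 ⟨hω.symm ▸ hXω.1, hYω.2⟩ : Y ω ∈ S.powersetCard _) rfl
  have hYA : ∀ A ∈ S.powersetCard (min #S' s),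
      μ.real {ω | Y ω = A} = ((#S').choose (min #S' s) : ℝ)⁻¹ := fun A hA => by
    rw [measureReal_def, hY A ((Finset.mem_powersetCard.1 hA).1.trans hSS')
      (Finset.mem_powersetCard.1 hA).2, ENNReal.toReal_inv, ENNReal.toReal_natCast]
  calc μ.real {ω | Y ω = X ω}
      ≤ ∑ A ∈ S.powersetCard (min #S' s), μ.real {ω | Y ω = A} :=
        (ENNReal.toReal_mono (measure_ne_top _ _) (measure_mono_ae hsub)).trans
          (measureReal_biUnion_finset_le _ _)
    _ = subsetProb s #S #S' := by
        rw [Finset.sum_congr rfl hYA, Finset.sum_const, Finset.card_powersetCard, nsmul_eq_mul,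
          subsetProb, div_eq_mul_inv]

end Sample

section ExpectedCount

open Classical in
theorem integrable_card_filter_mem {Ω ι : Type*} [MeasurableSpace Ω] {μ : Measure Ω}
    [IsFiniteMeasure μ] {t : Finset ι} {G : ι → Set Ω} (hG : ∀ i ∈ t, MeasurableSet (G i)) :
    Integrable (fun ω => (#{i ∈ t | ω ∈ G i} : ℝ)) μ := by
  simp only [Finset.card_filter, Nat.cast_sum, Nat.cast_ite, Nat.cast_one, Nat.cast_zero]
  exact integrable_finsetSum _ fun i hi => (integrable_const (1 : ℝ)).indicator (hG i hi)

open Classical in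
theorem integral_card_filter_mem {Ω ι : Type*} [MeasurableSpace Ω] {μ : Measure Ω}
    [IsFiniteMeasure μ] {t : Finset ι} {G : ι → Set Ω} (hG : ∀ i ∈ t, MeasurableSet (G i)) :
    ∫ ω, (#{i ∈ t | ω ∈ G i} : ℝ) ∂μ = ∑ i ∈ t, μ.real (G i) := by
  simp only [Finset.card_filter, Nat.cast_sum, Nat.cast_ite, Nat.cast_one, Nat.cast_zero]
  exact (integral_finsetSum _ fun i hi => (integrable_const (1 : ℝ)).indicator (hG i hi)).trans
    (Finset.sum_congr rfl fun i hi => integral_indicator_one (hG i hi))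

theorem card_increase_le {M : ℕ → ℕ} (hM : Monotone M) (N B : ℕ) :
    #{v ∈ Finset.range N | M v < M (v + 1) ∧ M v < B} ≤ B := by
  rw [← Finset.card_range B]
  refine Finset.card_le_card_of_injOn M (fun v hv => by simp_all) fun v hv v' hv' h => ?_
  by_contra hne
  rcases lt_or_gt_of_ne hne with hlt | hlt
  · exact ((Finset.mem_filter.1 hv).2.1.trans_le (hM hlt)).ne h
  · exact ((Finset.mem_filter.1 hv').2.1.trans_le (hM hlt)).ne' h

theorem sum_measureReal_increase_le {Ω : Type*} [MeasurableSpace Ω] {μ : Measure Ω}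
    [IsProbabilityMeasure μ] {M : ℕ → Ω → ℕ} (hm : ∀ v, Measurable (M v))
    (hM : ∀ ω, Monotone fun v => M v ω) (N B : ℕ) :
    ∑ v ∈ Finset.range N, μ.real {ω | M v ω < M (v + 1) ω ∧ M v ω < B} ≤ B := by
  have hmeas : ∀ v ∈ Finset.range N, MeasurableSet {ω | M v ω < M (v + 1) ω ∧ M v ω < B} :=
    fun v _ => (measurableSet_lt (hm v) (hm (v + 1))).inter
      (measurableSet_lt (hm v) measurable_const)
  rw [← integral_card_filter_mem hmeas]
  refine (integral_mono (integrable_card_filter_mem hmeas) (integrable_const (B : ℝ))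
    fun ω => ?_).trans_eq (by simp)
  have hcard := card_increase_le (hM ω) N B
  simp only [Set.mem_ofPred_eq]
  exact_mod_cast hcard

open Classical in
theorem mul_measureReal_le_sum_of_le_card {Ω ι : Type*} [MeasurableSpace Ω] {μ : Measure Ω}
    [IsFiniteMeasure μ] {t : Finset ι} {G : ι → Set Ω} (hG : ∀ i ∈ t, MeasurableSet (G i))
    {A : Set Ω} {c : ℝ} (hc : 0 ≤ c) (hA : ∀ ω ∈ A, c ≤ #{i ∈ t | ω ∈ G i}) :
    c * μ.real A ≤ ∑ i ∈ t, μ.real (G i) :=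
  calc c * μ.real A ≤ c * μ.real {ω | c ≤ #{i ∈ t | ω ∈ G i}} :=
        mul_le_mul_of_nonneg_left (measureReal_mono hA) hc
    _ ≤ ∫ ω, (#{i ∈ t | ω ∈ G i} : ℝ) ∂μ :=
        mul_meas_ge_le_integral_of_nonneg (.of_forall fun _ => Nat.cast_nonneg _)
          (integrable_card_filter_mem hG) c
    _ = _ := integral_card_filter_mem hG

end ExpectedCount

section Silence

variable {k : ℕ} {α Ω U D : Type*} [MeasurableSpace Ω] {μ : Measure Ω} [IsProbabilityMeasure μ]
  {P : Protocol k α Ω U D} {s : ℕ}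

theorem Protocol.Correct.measureReal_sampleAt_eq_le (hP : P.IsMeasurable) (hc : P.Correct μ s)
    {x : Input k α} (hx : x.Distinct) (j : Fin k) {t r : ℕ} (htr : t ≤ r + 1) :
    μ.real {ω | P.sampleAt ω (x.isolate j t) r = P.sampleAt ω (x.truncate t) r} ≤
      subsetProb s #(x.arrived t) #((x.isolate j t).arrived (r + 1)) :=
  IsUniformSample.measureReal_eq_le (x.arrived_truncate htr ▸ hc _ (hx.truncate t) r)
    (hc _ (hx.isolate j t) r) (x.arrived_subset_arrived_isolate j htr)
    (fun A => hP.sample _ r A) (fun A => hP.sample _ r A)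

theorem Protocol.Correct.measureReal_linkSilent_le (hP : P.IsMeasurable) (hc : P.Correct μ s)
    {x : Input k α} (hx : x.Distinct) (j : Fin k) {t R : ℕ} (htR : t < R) (B : ℕ) :
    μ.real {ω | P.LinkSilent ω x j (Finset.Ico t R) ∧ P.messages ω x t < B} ≤
      subsetProb s #(x.arrived t) #((x.isolate j t).arrived R) +
        μ.real {ω | P.messages ω (x.truncate t) t < P.messages ω (x.truncate t) R ∧
          P.messages ω (x.truncate t) t < B} := by
  obtain ⟨r, rfl⟩ := Nat.exists_eq_succ_of_ne_zero (Nat.ne_zero_of_lt htR)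
  refine le_trans (measureReal_mono fun ω ⟨hsilent, hB⟩ => ?_) ((measureReal_union_le _ _).trans
    (add_le_add_left (hc.measureReal_sampleAt_eq_le hP hx j htR.le) _))
  rw [← messages_congr fun r hr => Input.truncate_of_lt hr] at hB
  rcases (P.messages_mono ω (x.truncate t) htR.le).lt_or_eq with hlt | heq
  · exact Or.inr ⟨hlt, hB⟩
  · refine Or.inl (congrArg (P.sample ω) ?_)
    exact (run_isolate_of_linkSilent htR.le hsilent (linkSilent_Ico_of_messages_eq heq)).1

end Silence

theorem expect_expect_update {ι β M : Type*} [Fintype ι] [DecidableEq ι] [Fintype β]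
    [AddCommMonoid M] [Module ℚ≥0 M] (g : (ι → β) → M) (i : ι) :
    𝔼 u, 𝔼 v, g (Function.update u i v) = 𝔼 u, g u := by
  have hswap : Function.Involutive fun p : (ι → β) × β => (Function.update p.1 i p.2, p.1 i) :=
    fun p => by simp
  calc 𝔼 u, 𝔼 v, g (Function.update u i v)
      = 𝔼 p : (ι → β) × β, g (Function.update p.1 i p.2) := by
        rw [← Finset.univ_product_univ, Finset.expect_product]
    _ = 𝔼 p : (ι → β) × β, g p.1 :=
        Fintype.expect_equiv hswap.toPerm _ _ fun _ => rfl
    _ = 𝔼 u, 𝔼 _v : β, g u := by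
        rw [← Finset.univ_product_univ, Finset.expect_product]
    _ = 𝔼 u, g u := Finset.expect_congr rfl fun u _ =>
        Finset.expect_const ⟨u i, Finset.mem_univ _⟩ _

/-- The shape of a random input: it is divided into stages, and in stage `i` site `j` observes
`len i j` elements. Only the stages `i < stages` matter. -/
structure Schedule (k : ℕ) where
  stages : ℕ
  len : ℕ → Fin k → ℕ

namespace Schedule

variable {k : ℕ} (Q : Schedule k)

/-- The number of elements that arrive before stage `i`. -/
def before (i : ℕ) : ℕ := ∑ i' ∈ Finset.range i, ∑ j, Q.len i' j

/-- The number of elements that arrive altogether. -/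
def total : ℕ := Q.before Q.stages

/-- The observations of a schedule: the pair `⟨(i, j), ℓ⟩` is the observation number `ℓ` that site
`j` makes in stage `i`. -/
abbrev Cell : Type := Σ p : Fin Q.stages × Fin k, Fin (Q.len p.1 p.2)

/-- The number of rounds of a slot: enough for all the elements, and never `0`. -/
def width : ℕ := Q.total + 1

/-- Every stage has `N` slots, and makes use of a single one of them, namely slot `u i` in stage
`i`. This is the position of that slot among all the slots of all the stages. -/
def slotIndex {E N : ℕ} (u : Fin E → Fin N) (i : Fin E) : ℕ := i * N + u i

/-- The rounds that make up the slot used in stage `i`. -/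
def window {N : ℕ} (u : Fin Q.stages → Fin N) (i : Fin Q.stages) : Finset ℕ :=
  Finset.Ico (slotIndex u i * Q.width) ((slotIndex u i + 1) * Q.width)

/-- The number of rounds taken by all the stages. -/
def rounds (N : ℕ) : ℕ := Q.stages * N * Q.width

/-- The round and the site of an observation. -/
def place {N : ℕ} (u : Fin Q.stages → Fin N) (c : Q.Cell) : ℕ × Fin k :=
  (slotIndex u c.1.1 * Q.width + c.2, c.1.2)

/-- The input in which the elements arrive as scheduled, each site being served one element per
round from the start of the slot on. -/
noncomputable def input {α : Type*} {N : ℕ} (item : Q.Cell ↪ α) (u : Fin Q.stages → Fin N) :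
    Input k α :=
  fun r j => ((Q.place u).partialInv (r, j)).map item

section Slots

variable {E N : ℕ} (u : Fin E → Fin N)

theorem slotIndex_lt_mul_iff {i : Fin E} {m : ℕ} : slotIndex u i < m * N ↔ (i : ℕ) < m := by
  have hN : 0 < N := (u i).pos
  rw [← Nat.div_lt_iff_lt_mul hN, slotIndex, Nat.add_comm, Nat.add_mul_div_right _ _ hN,
    Nat.div_eq_of_lt (u i).isLt, Nat.zero_add]

theorem slotIndex_strictMono : StrictMono (slotIndex u) := fun i i' h =>
  calc slotIndex u i < (i + 1) * N := (slotIndex_lt_mul_iff u).2 (Nat.lt_succ_self _)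
    _ ≤ i' * N := Nat.mul_le_mul_right N h
    _ ≤ slotIndex u i' := Nat.le_add_right _ _

end Slots

theorem before_mono : Monotone Q.before := fun _ _ h =>
  Finset.sum_le_sum_of_subset (Finset.range_mono h)

theorem len_lt_width (p : Fin Q.stages × Fin k) : Q.len p.1 p.2 < Q.width :=
  Nat.lt_succ_of_le <|
    calc Q.len p.1 p.2 ≤ ∑ j, Q.len p.1 j :=
          Finset.single_le_sum_of_canonicallyOrdered (Finset.mem_univ p.2)
      _ ≤ Q.before (p.1 + 1) := by
          rw [before, Finset.sum_range_succ]
          exact Nat.le_add_left _ _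
      _ ≤ Q.total := Q.before_mono p.1.isLt

variable {N : ℕ} (u : Fin Q.stages → Fin N)

theorem place_fst_div_width (c : Q.Cell) : (Q.place u c).1 / Q.width = slotIndex u c.1.1 := by
  have hc : (c.2 : ℕ) < Q.width := c.2.isLt.trans (Q.len_lt_width c.1)
  rw [place, Nat.add_comm, Nat.add_mul_div_right _ _ hc.pos, Nat.div_eq_of_lt hc, Nat.zero_add]

theorem place_fst_lt_mul_width_iff {c : Q.Cell} {m : ℕ} :
    (Q.place u c).1 < m * Q.width ↔ slotIndex u c.1.1 < m := by
  have hwidth : 0 < Q.width := Nat.succ_pos _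
  rw [← Nat.div_lt_iff_lt_mul hwidth, place_fst_div_width]

theorem place_injective : Function.Injective (Q.place u) := by
  rintro ⟨⟨i, j⟩, ℓ⟩ ⟨⟨i', j'⟩, ℓ'⟩ h
  obtain rfl : i = i' := (slotIndex_strictMono u).injective <| by
    rw [← Q.place_fst_div_width u ⟨(i, j), ℓ⟩, h, place_fst_div_width]
  obtain rfl : j = j' := congrArg Prod.snd h
  obtain rfl : ℓ = ℓ' := Fin.ext (Nat.add_left_cancel (congrArg Prod.fst h))
  rfl

theorem pairwise_disjoint_window : Pairwise (Function.onFun Disjoint (Q.window u)) := by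
  intro i i' hne
  refine Finset.disjoint_left.2 fun r hr hr' => hne ((slotIndex_strictMono u).injective ?_)
  rw [window, Finset.mem_Ico] at hr hr'
  exact (Nat.div_eq_of_lt_le hr.1 hr.2).symm.trans (Nat.div_eq_of_lt_le hr'.1 hr'.2)

theorem window_subset_range (i : Fin Q.stages) : Q.window u i ⊆ Finset.range (Q.rounds N) := by
  rw [window, Finset.range_eq_Ico]
  refine Finset.Ico_subset_Ico (Nat.zero_le _) (Nat.mul_le_mul_right _ ?_)
  exact (slotIndex_lt_mul_iff u).2 i.isLt

variable {α : Type*} (item : Q.Cell ↪ α)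

theorem input_eq_some_iff {r : ℕ} {j : Fin k} {a : α} :
    Q.input item u r j = some a ↔ ∃ c, Q.place u c = (r, j) ∧ item c = a := by
  simp only [input, Option.map_eq_some_iff,
    (Q.place_injective u).isPartialInv _ _]

theorem distinct_input : (Q.input item u).Distinct := by
  intro r j r' j' a h h'
  obtain ⟨c, hc, hca⟩ := (Q.input_eq_some_iff u item).1 h
  obtain ⟨c', hc', hca'⟩ := (Q.input_eq_some_iff u item).1 h'
  obtain rfl := item.injective (hca.trans hca'.symm)
  exact Prod.ext_iff.1 (hc.symm.trans hc')

theorem arrived_input (R : ℕ) :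
    (Q.input item u).arrived R = ({c | (Q.place u c).1 < R} : Finset Q.Cell).map item := by
  ext a
  simp only [Input.mem_arrived, input_eq_some_iff, Finset.mem_map, Finset.mem_filter_univ]
  constructor
  · rintro ⟨r, hr, j, c, hc, rfl⟩
    exact ⟨c, by rwa [hc], rfl⟩
  · rintro ⟨c, hc, rfl⟩
    exact ⟨_, hc, _, c, rfl, rfl⟩

theorem arrived_isolate_input (j : Fin k) (t R : ℕ) :
    ((Q.input item u).isolate j t).arrived R = ({c | (Q.place u c).1 < R ∧
      ((Q.place u c).1 < t ∨ c.1.2 = j)} : Finset Q.Cell).map item := by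
  ext a
  simp only [Input.mem_arrived, Input.isolate_eq_some_iff, input_eq_some_iff, Finset.mem_map,
    Finset.mem_filter_univ]
  constructor
  · rintro ⟨r, hr, i, hi, c, hc, rfl⟩
    obtain ⟨rfl, rfl⟩ := Prod.ext_iff.1 hc
    exact ⟨c, ⟨hr, hi⟩, rfl⟩
  · rintro ⟨c, ⟨hr, hi⟩, rfl⟩
    exact ⟨_, hr, _, hi, c, rfl, rfl⟩

theorem card_cell_filter (p : Fin Q.stages × Fin k → Prop) [DecidablePred p] :
    #{c : Q.Cell | p c.1} = ∑ x with p x, Q.len x.1 x.2 := by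
  have hsigma : ({c | p c.1} : Finset Q.Cell) =
      ({x | p x} : Finset (Fin Q.stages × Fin k)).sigma fun _ => Finset.univ := by
    ext c
    simp
  simp only [hsigma, Finset.card_sigma, Finset.card_univ, Fintype.card_fin]

theorem sum_len_eq_before {m : ℕ} (hm : m ≤ Q.stages) :
    ∑ x : Fin Q.stages × Fin k with (x.1 : ℕ) < m, Q.len x.1 x.2 = Q.before m := by
  rw [Finset.sum_filter, Fintype.sum_prod_type,
    Fin.sum_univ_eq_sum_range (fun i => ∑ j, if i < m then Q.len i j else 0), before]
  refine ((Finset.sum_subset (Finset.range_mono hm) fun i _ hi => ?_).symm).trans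
    (Finset.sum_congr rfl fun i hi => ?_)
  · simp [Finset.mem_range.not.1 hi]
  · simp [Finset.mem_range.1 hi]

theorem card_arrived_input_rounds : #((Q.input item u).arrived (Q.rounds N)) = Q.total := by
  simp only [arrived_input, Finset.card_map, rounds, place_fst_lt_mul_width_iff,
    slotIndex_lt_mul_iff]
  exact (Q.card_cell_filter _).trans (Q.sum_len_eq_before le_rfl)

theorem card_arrived_input_slot (i : Fin Q.stages) :
    #((Q.input item u).arrived (slotIndex u i * Q.width)) = Q.before i := by
  simp only [arrived_input, Finset.card_map, place_fst_lt_mul_width_iff,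
    (slotIndex_strictMono u).lt_iff_lt]
  exact (Q.card_cell_filter _).trans (Q.sum_len_eq_before i.isLt.le)

theorem card_arrived_isolate_input_slot (i : Fin Q.stages) (j : Fin k) :
    #(((Q.input item u).isolate j (slotIndex u i * Q.width)).arrived
      ((slotIndex u i + 1) * Q.width)) = Q.before i + Q.len i j := by
  simp only [arrived_isolate_input, Finset.card_map, place_fst_lt_mul_width_iff,
    Nat.lt_succ_iff, (slotIndex_strictMono u).lt_iff_lt, (slotIndex_strictMono u).le_iff_le]
  have hinsert : ({x | x.1 ≤ i ∧ (x.1 < i ∨ x.2 = j)} : Finset (Fin Q.stages × Fin k)) =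
      insert (i, j) ({x | (x.1 : ℕ) < i} : Finset _) := by
    ext ⟨i', j'⟩
    simp only [Finset.mem_filter_univ, Finset.mem_insert, Prod.mk.injEq, Fin.val_fin_lt]
    grind
  rw [Q.card_cell_filter fun x => x.1 ≤ i ∧ (x.1 < i ∨ x.2 = j), hinsert,
    Finset.sum_insert (by simp), Q.sum_len_eq_before i.isLt.le, Nat.add_comm]

theorem truncate_input_eq_some_iff {i : Fin Q.stages} {r : ℕ} {j : Fin k} {a : α} :
    (Q.input item u).truncate (slotIndex u i * Q.width) r j = some a ↔
      ∃ c : Q.Cell, c.1.1 < i ∧ Q.place u c = (r, j) ∧ item c = a := by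
  rw [Input.truncate_eq_some_iff, input_eq_some_iff, ← exists_and_left]
  refine exists_congr fun c => and_congr_left fun ⟨hc, _⟩ => ?_
  rw [← (slotIndex_strictMono u).lt_iff_lt, ← place_fst_lt_mul_width_iff, hc]

theorem truncate_input_update (i : Fin Q.stages) (v : Fin N) :
    (Q.input item (Function.update u i v)).truncate
        (slotIndex (Function.update u i v) i * Q.width) =
      (Q.input item u).truncate (slotIndex u i * Q.width) := by
  funext r j
  refine Option.ext fun a => ?_
  rw [truncate_input_eq_some_iff, truncate_input_eq_some_iff]
  refine exists_congr fun c => and_congr_right fun hc => ?_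
  simp only [place, slotIndex, Function.update_of_ne hc.ne]

end Schedule

section LowerBound

variable {k : ℕ} {α Ω U D : Type*} {P : Protocol k α Ω U D} {s : ℕ} {Q : Schedule k} {N : ℕ} {δ : ℝ}

/-- The pairs of a stage and a site such that, with probability at least `1 - δ`, a uniform sample
of what has arrived after the stage contains an element observed by the site in the stage, supposing
that nothing else arrives in this stage. -/
noncomputable def Schedule.hardPairs (Q : Schedule k) (s : ℕ) (δ : ℝ) :
    Finset (Fin Q.stages × Fin k) :=
  {p | subsetProb s (Q.before p.1) (Q.before p.1 + Q.len p.1 p.2) ≤ δ}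

open Classical in
theorem card_hardPairs_le_two_mul_card_linkSilent (item : Q.Cell ↪ α) (u : Fin Q.stages → Fin N)
    {ω : Ω} (hω : 2 * P.messages ω (Q.input item u) (Q.rounds N) < #(Q.hardPairs s δ)) :
    #(Q.hardPairs s δ) ≤ 2 * #{p ∈ Q.hardPairs s δ |
      P.LinkSilent ω (Q.input item u) p.2 (Q.window u p.1)} := by
  have hcount := P.card_not_linkSilent_le_messages (ω := ω) (x := Q.input item u)
    (Q.pairwise_disjoint_window u) (Q.window_subset_range u)
  have hle := Finset.card_le_card (Finset.filter_subset_filter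
    (fun p => ¬ P.LinkSilent ω (Q.input item u) p.2 (Q.window u p.1))
    (Finset.subset_univ (Q.hardPairs s δ)))
  have hsplit := Finset.card_filter_add_card_filter_not (s := Q.hardPairs s δ)
    fun p => P.LinkSilent ω (Q.input item u) p.2 (Q.window u p.1)
  lia

variable [MeasurableSpace Ω]

/-- If time is divided into slots of `w` rounds, the probability that messages are transmitted in
slot `m` after fewer than `B` messages in the slots before it. -/
noncomputable def activeProb (P : Protocol k α Ω U D) (μ : Measure Ω) (x : Input k α) (w B m : ℕ) :
    ℝ :=
  μ.real {ω | P.messages ω x (m * w) < P.messages ω x ((m + 1) * w) ∧ P.messages ω x (m * w) < B}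

variable {μ : Measure Ω} [IsProbabilityMeasure μ]

theorem expect_activeProb_le (hP : P.IsMeasurable) (x : Input k α) (w B m N : ℕ) :
    𝔼 v : Fin N, activeProb P μ x w B (m + v) ≤ B / N := by
  rw [Fintype.expect_eq_sum_div_card, Fintype.card_fin,
    Fin.sum_univ_eq_sum_range fun v => activeProb P μ x w B (m + v)]
  gcongr
  exact sum_measureReal_increase_le (M := fun v ω => P.messages ω x ((m + v) * w))
    (fun v => hP.messages x _) (fun ω v v' h => P.messages_mono ω x (by gcongr)) N B

theorem measureReal_linkSilent_window_le (hP : P.IsMeasurable) (hc : P.Correct μ s)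
    (item : Q.Cell ↪ α) (u : Fin Q.stages → Fin N) {p : Fin Q.stages × Fin k}
    (hp : p ∈ Q.hardPairs s δ) (B : ℕ) :
    μ.real {ω | P.LinkSilent ω (Q.input item u) p.2 (Q.window u p.1) ∧
        P.messages ω (Q.input item u) (Q.rounds N) < B} ≤
      δ + activeProb P μ ((Q.input item u).truncate (Schedule.slotIndex u p.1 * Q.width)) Q.width B
        (Schedule.slotIndex u p.1) := by
  have hstart : Schedule.slotIndex u p.1 * Q.width ≤ Q.rounds N :=
    Nat.mul_le_mul_right _ ((Schedule.slotIndex_lt_mul_iff u).2 p.1.isLt).le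
  have hsub : {ω | P.LinkSilent ω (Q.input item u) p.2 (Q.window u p.1) ∧
        P.messages ω (Q.input item u) (Q.rounds N) < B} ⊆
      {ω | P.LinkSilent ω (Q.input item u) p.2 (Q.window u p.1) ∧
        P.messages ω (Q.input item u) (Schedule.slotIndex u p.1 * Q.width) < B} :=
    fun ω hω => ⟨hω.1, (P.messages_mono ω _ hstart).trans_lt hω.2⟩
  have hslot : Schedule.slotIndex u p.1 * Q.width < (Schedule.slotIndex u p.1 + 1) * Q.width :=
    Nat.mul_lt_mul_of_pos_right (Nat.lt_succ_self _) Q.total.succ_pos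
  refine (measureReal_mono hsub).trans
    ((hc.measureReal_linkSilent_le hP (Q.distinct_input u item) p.2 hslot B).trans ?_)
  rw [Q.card_arrived_input_slot, Q.card_arrived_isolate_input_slot]
  exact add_le_add_left (Finset.mem_filter.1 hp).2 _

theorem expect_linkSilent_window_le [NeZero N] (hP : P.IsMeasurable) (hc : P.Correct μ s)
    (item : Q.Cell ↪ α) {p : Fin Q.stages × Fin k} (hp : p ∈ Q.hardPairs s δ) (B : ℕ) :
    𝔼 u : Fin Q.stages → Fin N,
      μ.real {ω | P.LinkSilent ω (Q.input item u) p.2 (Q.window u p.1) ∧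
        P.messages ω (Q.input item u) (Q.rounds N) < B} ≤ δ + B / N := by
  let x₀ (u : Fin Q.stages → Fin N) : Input k α :=
    (Q.input item u).truncate (Schedule.slotIndex u p.1 * Q.width)
  calc
    _ ≤ 𝔼 u, (δ + activeProb P μ (x₀ u) Q.width B (Schedule.slotIndex u p.1)) :=
      Finset.expect_le_expect fun u _ => measureReal_linkSilent_window_le hP hc item u hp B
    _ = δ + 𝔼 u, activeProb P μ (x₀ u) Q.width B (Schedule.slotIndex u p.1) := by
      rw [Finset.expect_add_distrib, Fintype.expect_const]
    _ = δ + 𝔼 u, 𝔼 v : Fin N, activeProb P μ (x₀ u) Q.width B (p.1 * N + v) := by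
      rw [← expect_expect_update _ p.1]
      simp only [x₀, Q.truncate_input_update]
      simp only [Schedule.slotIndex, Function.update_self]
    _ ≤ δ + 𝔼 _u : Fin Q.stages → Fin N, (B / N : ℝ) := by
      gcongr
      exact expect_activeProb_le hP _ _ _ _ _
    _ = δ + B / N := by rw [Fintype.expect_const]

theorem expect_messages_lt_half_le [NeZero N] (hP : P.IsMeasurable) (hc : P.Correct μ s)
    (item : Q.Cell ↪ α) (hK : 0 < #(Q.hardPairs s δ)) :
    𝔼 u : Fin Q.stages → Fin N,
      μ.real {ω | (P.messages ω (Q.input item u) (Q.rounds N) : ℝ) < #(Q.hardPairs s δ) / 2} ≤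
      2 * (δ + #(Q.hardPairs s δ) / N) := by
  set K := #(Q.hardPairs s δ)
  let G (u : Fin Q.stages → Fin N) (p : Fin Q.stages × Fin k) : Set Ω :=
    {ω | P.LinkSilent ω (Q.input item u) p.2 (Q.window u p.1) ∧
      P.messages ω (Q.input item u) (Q.rounds N) < K}
  have hG (u) (p) : MeasurableSet (G u p) :=
    (hP.linkSilent _ _ _).inter (measurableSet_lt (hP.messages _ _) measurable_const)
  have hu (u : Fin Q.stages → Fin N) :
      (K / 2 : ℝ) * μ.real {ω | (P.messages ω (Q.input item u) (Q.rounds N) : ℝ) < K / 2} ≤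
        ∑ p ∈ Q.hardPairs s δ, μ.real (G u p) := by
    classical
    refine mul_measureReal_le_sum_of_le_card (fun p _ => hG u p) (by positivity) fun ω hω => ?_
    have hfew : 2 * P.messages ω (Q.input item u) (Q.rounds N) < K := by
      rw [Set.mem_ofPred_eq, lt_div_iff₀' two_pos] at hω
      exact_mod_cast hω
    have hlt : P.messages ω (Q.input item u) (Q.rounds N) < K := by lia
    simp only [G, Set.mem_ofPred_eq, hlt, and_true]
    rw [div_le_iff₀' two_pos]
    exact_mod_cast card_hardPairs_le_two_mul_card_linkSilent item u hfew
  have hsum : (K / 2 : ℝ) * 𝔼 u : Fin Q.stages → Fin N,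
      μ.real {ω | (P.messages ω (Q.input item u) (Q.rounds N) : ℝ) < K / 2} ≤
        K * (δ + K / N) := calc
    _ ≤ 𝔼 u, ∑ p ∈ Q.hardPairs s δ, μ.real (G u p) := by
      rw [Finset.mul_expect]
      exact Finset.expect_le_expect fun u _ => hu u
    _ = ∑ p ∈ Q.hardPairs s δ, 𝔼 u, μ.real (G u p) := Finset.expect_sum_comm _ _ _
    _ ≤ ∑ _p ∈ Q.hardPairs s δ, (δ + K / N) :=
      Finset.sum_le_sum fun p hp => expect_linkSilent_window_le hP hc item hp K
    _ = K * (δ + K / N) := by rw [Finset.sum_const, nsmul_eq_mul]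
  refine le_of_mul_le_mul_left (hsum.trans_eq ?_) (half_pos (Nat.cast_pos.2 hK))
  ring

theorem le_expect_half_le_messages [NeZero N] (hP : P.IsMeasurable) (hc : P.Correct μ s)
    (item : Q.Cell ↪ α) (hK : 0 < #(Q.hardPairs s δ)) :
    1 - 2 * (δ + #(Q.hardPairs s δ) / N) ≤ 𝔼 u : Fin Q.stages → Fin N,
      μ.real {ω | (#(Q.hardPairs s δ) / 2 : ℝ) ≤ P.messages ω (Q.input item u) (Q.rounds N)} := by
  have hcompl (u : Fin Q.stages → Fin N) :
      μ.real {ω | (#(Q.hardPairs s δ) / 2 : ℝ) ≤ P.messages ω (Q.input item u) (Q.rounds N)} =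
        1 - μ.real
          {ω | (P.messages ω (Q.input item u) (Q.rounds N) : ℝ) < #(Q.hardPairs s δ) / 2} := by
    rw [← probReal_compl_eq_one_sub]
    · simp only [Set.compl_ofPred, not_lt]
    · exact measurableSet_lt ((measurable_of_countable _).comp (hP.messages _ _)) measurable_const
  simp only [hcompl]
  rw [Finset.expect_sub_distrib, Fintype.expect_const]
  exact sub_le_sub_left (expect_messages_lt_half_le hP hc item hK) 1

end LowerBound

section Construction

variable {k s : ℕ} {δ : ℝ}

theorem choose_add_mul_choose_le (m s L : ℕ) :
    m.choose (s + 1) + L * m.choose s ≤ (m + L).choose (s + 1) := by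
  induction L with
  | zero => simp
  | succ L ih =>
    rw [← Nat.add_assoc, Nat.choose_succ_succ', Nat.add_mul, Nat.one_mul]
    have := Nat.choose_le_choose s (Nat.le_add_right m L)
    lia

theorem succ_mul_choose_le_choose_add {A m L : ℕ} (hs : 1 ≤ s) (hL : A * m ≤ s * L) :
    (A + 1) * m.choose s ≤ (m + L).choose s := by
  obtain ⟨s, rfl⟩ := Nat.exists_eq_add_of_le' hs
  have hchoose : A * m.choose (s + 1) ≤ L * m.choose s := by
    refine Nat.le_of_mul_le_mul_left ?_ (Nat.succ_pos s)
    calc (s + 1) * (A * m.choose (s + 1)) = A * (m.choose (s + 1) * (s + 1)) := by ring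
      _ = A * (m.choose s * (m - s)) := by rw [Nat.choose_succ_right_eq]
      _ ≤ A * (m.choose s * m) := by gcongr; exact Nat.sub_le m s
      _ = A * m * m.choose s := by ring
      _ ≤ (s + 1) * L * m.choose s := by gcongr
      _ = (s + 1) * (L * m.choose s) := by ring
  calc (A + 1) * m.choose (s + 1) = m.choose (s + 1) + A * m.choose (s + 1) := by ring
    _ ≤ m.choose (s + 1) + L * m.choose s := by gcongr
    _ ≤ (m + L).choose (s + 1) := choose_add_mul_choose_le m s L

theorem subsetProb_add_le {A m L : ℕ} (hδ : 1 ≤ δ * (A + 1)) (hs : 1 ≤ s) (hm : s ≤ m)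
    (hL : A * m ≤ s * L) : subsetProb s m (m + L) ≤ δ := by
  rw [subsetProb_le_iff, min_eq_right (hm.trans (Nat.le_add_right m L))]
  have hδ0 : 0 < δ := pos_of_mul_pos_left (zero_lt_one.trans_le hδ) (by positivity)
  have hchoose : ((A : ℝ) + 1) * m.choose s ≤ (m + L).choose s := by
    exact_mod_cast succ_mul_choose_le_choose_add hs hL
  calc (m.choose s : ℝ) ≤ δ * (A + 1) * m.choose s := le_mul_of_one_le_left (by positivity) hδ
    _ = δ * ((A + 1) * m.choose s) := mul_assoc _ _ _
    _ ≤ δ * (m + L).choose s := by gcongr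

theorem subsetProb_succ_le {m : ℕ} (hδ : 0 ≤ δ) (hm : m < s) : subsetProb s m (m + 1) ≤ δ := by
  rw [subsetProb_le_iff, min_eq_left hm, Nat.choose_succ_self, Nat.cast_zero]
  positivity

namespace Schedule

variable (Q : Schedule k) (ℓ : Fin k → ℕ)

/-- The schedule `Q` followed by one more stage, in which site `j` observes `ℓ j` elements. -/
def snoc : Schedule k where
  stages := Q.stages + 1
  len := Function.update Q.len Q.stages ℓ

theorem len_snoc_self : (Q.snoc ℓ).len Q.stages = ℓ := Function.update_self _ _ _

theorem len_snoc_of_lt {i : ℕ} (hi : i < Q.stages) : (Q.snoc ℓ).len i = Q.len i :=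
  Function.update_of_ne hi.ne _ _

theorem before_snoc {i : ℕ} (hi : i ≤ Q.stages) : (Q.snoc ℓ).before i = Q.before i :=
  Finset.sum_congr rfl fun i' hi' => by
    rw [Q.len_snoc_of_lt ℓ ((Finset.mem_range.1 hi').trans_le hi)]

theorem total_snoc : (Q.snoc ℓ).total = Q.total + ∑ j, ℓ j :=
  calc (Q.snoc ℓ).total = (Q.snoc ℓ).before Q.stages + ∑ j, (Q.snoc ℓ).len Q.stages j :=
        Finset.sum_range_succ _ _
    _ = Q.total + ∑ j, ℓ j := by rw [Q.before_snoc ℓ le_rfl, len_snoc_self, total]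

theorem card_hardPairs : #(Q.hardPairs s δ) = ∑ i ∈ Finset.range Q.stages,
    #{j | subsetProb s (Q.before i) (Q.before i + Q.len i j) ≤ δ} := by
  simp only [hardPairs, Finset.card_filter]
  rw [Fintype.sum_prod_type, Fin.sum_univ_eq_sum_range fun i =>
    ∑ j, if subsetProb s (Q.before i) (Q.before i + Q.len i j) ≤ δ then 1 else 0]

theorem card_hardPairs_snoc : #((Q.snoc ℓ).hardPairs s δ) =
    #(Q.hardPairs s δ) + #{j | subsetProb s Q.total (Q.total + ℓ j) ≤ δ} := by
  have hstages : (Q.snoc ℓ).stages = Q.stages + 1 := rfl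
  rw [card_hardPairs, card_hardPairs, hstages, Finset.sum_range_succ,
    len_snoc_self, Q.before_snoc ℓ le_rfl, total]
  refine congrArg (· + _) (Finset.sum_congr rfl fun i hi => ?_)
  rw [Finset.mem_range] at hi
  rw [Q.before_snoc ℓ hi.le, Q.len_snoc_of_lt ℓ hi]

end Schedule

/-- Some schedule for `k` sites has `n` elements and at least `h` hard pairs. -/
def Attainable (k s : ℕ) (δ : ℝ) (n h : ℕ) : Prop :=
  ∃ Q : Schedule k, Q.total = n ∧ h ≤ #(Q.hardPairs s δ)

namespace Attainable

variable {n h : ℕ}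

theorem zero : Attainable k s δ 0 0 := ⟨⟨0, fun _ _ => 0⟩, rfl, Nat.zero_le _⟩

theorem add_mul (hn : Attainable k s δ n h) {c L : ℕ} (hc : c ≤ k)
    (hL : subsetProb s n (n + L) ≤ δ) : Attainable k s δ (n + c * L) (h + c) := by
  obtain ⟨Q, rfl, hh⟩ := hn
  have hcard : #{j : Fin k | (j : ℕ) < c} = c := by
    rw [Fin.card_filter_val_lt, min_eq_right hc]
  refine ⟨Q.snoc fun j => if (j : ℕ) < c then L else 0, ?_, ?_⟩
  · rw [Q.total_snoc, ← Finset.sum_filter, Finset.sum_const, hcard, smul_eq_mul]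
  · rw [Q.card_hardPairs_snoc]
    refine Nat.add_le_add hh (hcard.symm.trans_le (Finset.card_le_card fun j hj => ?_))
    rw [Finset.mem_filter_univ] at hj ⊢
    rwa [if_pos hj]

theorem add_right (hn : Attainable k s δ n h) (hk : 1 ≤ k) (r : ℕ) :
    Attainable k s δ (n + r) h := by
  obtain ⟨Q, rfl, hh⟩ := hn
  refine ⟨Q.snoc (Pi.single ⟨0, hk⟩ r), ?_, ?_⟩
  · rw [Q.total_snoc, Finset.sum_pi_single', if_pos (Finset.mem_univ _)]
  · rw [Q.card_hardPairs_snoc]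
    exact hh.trans (Nat.le_add_right _ _)

theorem of_le (hδ : 0 ≤ δ) (hk : 1 ≤ k) (hn : n ≤ s) : Attainable k s δ n n := by
  induction n with
  | zero => exact zero
  | succ n ih =>
    simpa only [Nat.mul_one] using (ih (Nat.le_of_succ_le hn)).add_mul hk (subsetProb_succ_le hδ hn)

end Attainable

/-- The number of elements before the stage number `i`, when the first `s` elements are followed by
stages in which every site observes more than `A / s` times as many elements as have arrived
before. This is just enough for all the pairs of these stages to be hard. -/
def stageCount (A k s : ℕ) : ℕ → ℕ
  | 0 => s
  | i + 1 => stageCount A k s i + k * (A * stageCount A k s i / s + 1)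

theorem stageCount_strictMono (A : ℕ) (hk : 1 ≤ k) : StrictMono (stageCount A k s) :=
  strictMono_nat_of_lt_succ fun _ =>
    Nat.lt_add_of_pos_right (Nat.mul_pos hk (Nat.succ_pos _))

theorem le_stageCount (A : ℕ) (hk : 1 ≤ k) (i : ℕ) : s ≤ stageCount A k s i :=
  (stageCount_strictMono A hk).monotone (Nat.zero_le i)

theorem stageCount_le (A : ℕ) (hk : 1 ≤ k) (hs : 1 ≤ s) (i : ℕ) :
    (stageCount A k s i : ℝ) ≤ s * (1 + (A + 1) * (k / s)) ^ i := by
  have hs' : (0 : ℝ) < s := by exact_mod_cast hs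
  induction i with
  | zero => simp [stageCount]
  | succ i ih =>
    have hfloor : ((A * stageCount A k s i / s : ℕ) : ℝ) ≤ A * stageCount A k s i / s := by
      exact_mod_cast Nat.cast_div_le
    have hone : (1 : ℝ) ≤ stageCount A k s i / s :=
      (one_le_div hs').2 (by exact_mod_cast le_stageCount A hk i)
    rw [stageCount]
    push_cast
    calc (stageCount A k s i : ℝ) + k * (((A * stageCount A k s i / s : ℕ) : ℝ) + 1)
        ≤ stageCount A k s i + k * (A * stageCount A k s i / s + stageCount A k s i / s) := by
          gcongr
      _ = stageCount A k s i * (1 + (A + 1) * (k / s)) := by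
          field_simp
      _ ≤ s * (1 + (A + 1) * (k / s)) ^ (i + 1) := by
          rw [pow_succ, ← mul_assoc]
          gcongr

theorem subsetProb_stageCount_le {A : ℕ} (hδ : 1 ≤ δ * (A + 1)) (hk : 1 ≤ k) (hs : 1 ≤ s)
    (i : ℕ) : subsetProb s (stageCount A k s i)
      (stageCount A k s i + (A * stageCount A k s i / s + 1)) ≤ δ :=
  subsetProb_add_le hδ hs (le_stageCount A hk i) (Nat.lt_mul_div_succ _ hs).le

theorem attainable_stageCount {A : ℕ} (hδ : 1 ≤ δ * (A + 1)) (hk : 1 ≤ k) (hs : 1 ≤ s) (i : ℕ) :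
    Attainable k s δ (stageCount A k s i) (s + i * k) := by
  have hδ0 : 0 < δ := pos_of_mul_pos_left (zero_lt_one.trans_le hδ) (by positivity)
  induction i with
  | zero =>
    rw [Nat.zero_mul, Nat.add_zero]
    exact Attainable.of_le hδ0.le hk le_rfl
  | succ i ih =>
    rw [stageCount, Nat.succ_mul, ← Nat.add_assoc]
    exact ih.add_mul le_rfl (subsetProb_stageCount_le hδ hk hs i)

theorem log_one_add_mul_le {z : ℝ} (hz : 0 ≤ z) (m : ℕ) :
    Real.log (1 + m * z) ≤ m * Real.log (1 + z) := by
  rw [← Real.log_pow]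
  exact Real.log_le_log (by positivity) (one_add_mul_le_pow (by linarith) m)

theorem bound_le_of_le_pow {A n e : ℕ} (hk : 1 ≤ k) (hs : 1 ≤ s) (hn : 1 ≤ n)
    (h : (n : ℝ) ≤ s * (1 + (A + 1) * (k / s)) ^ e) : bound k s n ≤ e * (A + 1) * k := by
  have hs' : (0 : ℝ) < s := by exact_mod_cast hs
  have hz : (0 : ℝ) < k / s := div_pos (by exact_mod_cast hk) hs'
  have hlog : Real.log (n / s) ≤ e * ((A + 1) * Real.log (1 + k / s)) :=
    calc Real.log (n / s) ≤ Real.log ((1 + (A + 1) * (k / s)) ^ e) :=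
          Real.log_le_log (div_pos (by exact_mod_cast hn) hs') ((div_le_iff₀' hs').2 h)
      _ = e * Real.log (1 + (A + 1) * (k / s)) := Real.log_pow _ _
      _ ≤ e * ((A + 1) * Real.log (1 + k / s)) := by
          gcongr
          exact_mod_cast log_one_add_mul_le hz.le (A + 1)
  have hbound : bound k s n = k * Real.log (n / s) / Real.log (1 + k / s) := by
    rw [bound, Real.logb, Real.logb, mul_div_assoc,
      div_div_div_cancel_right₀ (Real.log_pos one_lt_two).ne', mul_div_assoc]
  rw [hbound, div_le_iff₀ (Real.log_pos (by linarith))]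
  calc (k : ℝ) * Real.log (n / s) ≤ k * (e * ((A + 1) * Real.log (1 + k / s))) := by gcongr
    _ = e * (A + 1) * k * Real.log (1 + k / s) := by ring

theorem exists_attainable_of_le {A n : ℕ} (hδ : 1 ≤ δ * (A + 1)) (hk : 1 ≤ k) (hs : 1 ≤ s)
    (hkn : k ≤ n) (hsn : s ≤ n) : ∃ e h : ℕ, n ≤ stageCount A k s (e + 1) ∧
      Attainable k s δ n h ∧ 0 < h ∧ (e + 1) * k ≤ 2 * (A + 1) * h := by
  have hmono := stageCount_strictMono (s := s) A hk
  obtain ⟨e, hlt, hle⟩ :=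
    hmono.exists_between_of_tendsto_atTop hmono.tendsto_atTop (Nat.lt_succ_of_le hsn)
  set m := stageCount A k s e with hm
  set L := A * m / s + 1 with hL
  have hLn : n - m < k * L := by
    rw [stageCount, ← hm, ← hL] at hle
    lia
  set p := (n - m) / L
  have hpk : p ≤ k := (Nat.div_lt_of_lt_mul (by rwa [Nat.mul_comm])).le
  have hn : m + p * L + (n - m) % L = n := by
    rw [Nat.add_assoc, Nat.div_add_mod']
    lia
  refine ⟨e, s + e * k + p, Nat.le_of_succ_le hle, ?_, by lia, ?_⟩
  · rw [← hn]
    exact ((attainable_stageCount hδ hk hs e).add_mul hpk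
      (subsetProb_stageCount_le hδ hk hs e)).add_right hk _
  · rcases Nat.eq_zero_or_pos e with rfl | he
    · have hL' : L = A + 1 := by
        rw [hL, hm, stageCount, Nat.mul_div_cancel _ hs]
      have hmod : (n - m) % L < L := Nat.mod_lt _ (Nat.succ_pos _)
      have hms : m = s := hm
      rw [hL'] at hmod hn
      nlinarith
    · nlinarith [Nat.mul_le_mul_right k he, Nat.zero_le (A * (s + e * k + p))]

theorem exists_schedule {A n : ℕ} (hδ : 1 ≤ δ * (A + 1)) (hk : 1 ≤ k) (hs : 1 ≤ s)
    (hkn : k ≤ n) : ∃ Q : Schedule k, Q.total = n ∧ 0 < #(Q.hardPairs s δ) ∧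
      bound k s n ≤ 2 * (A + 1) ^ 2 * #(Q.hardPairs s δ) := by
  have hδ0 : 0 < δ := pos_of_mul_pos_left (zero_lt_one.trans_le hδ) (by positivity)
  have hn : 1 ≤ n := hk.trans hkn
  rcases le_total n s with hns | hsn
  · obtain ⟨Q, hQ, hcard⟩ := Attainable.of_le hδ0.le hk hns
    refine ⟨Q, hQ, hn.trans hcard, ?_⟩
    calc bound k s n ≤ (0 : ℕ) * (A + 1) * k := by
          refine bound_le_of_le_pow hk hs hn ?_
          rw [pow_zero, mul_one]
          exact_mod_cast hns
      _ ≤ 2 * (A + 1) ^ 2 * #(Q.hardPairs s δ) := by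
          rw [Nat.cast_zero, zero_mul, zero_mul]
          positivity
  · obtain ⟨e, h, hne, ⟨Q, hQ, hcard⟩, hh, hek⟩ := exists_attainable_of_le hδ hk hs hkn hsn
    have hek' : ((e : ℝ) + 1) * k ≤ 2 * (A + 1) * h := by exact_mod_cast hek
    refine ⟨Q, hQ, hh.trans_le hcard, ?_⟩
    calc bound k s n ≤ (e + 1 : ℕ) * (A + 1) * k :=
          bound_le_of_le_pow hk hs hn ((Nat.cast_le.2 hne).trans (stageCount_le A hk hs _))
      _ = (A + 1) * ((e + 1) * k) := by push_cast; ring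
      _ ≤ (A + 1) * (2 * (A + 1) * h) := by gcongr
      _ = 2 * (A + 1) ^ 2 * h := by ring
      _ ≤ 2 * (A + 1) ^ 2 * #(Q.hardPairs s δ) := by gcongr

end Construction

section Mixture

theorem tsum_map_uniformOfFintype_mul {ι X : Type*} [Fintype ι] [Nonempty ι] (f : ι → X)
    (g : X → ℝ≥0∞) : ∑' x, (PMF.uniformOfFintype ι).map f x * g x =
      (Fintype.card ι : ℝ≥0∞)⁻¹ * ∑ i, g (f i) := by
  classical
  simp only [PMF.map_apply, ← ENNReal.tsum_mul_right]
  rw [ENNReal.tsum_comm, tsum_fintype, Finset.mul_sum]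
  refine Finset.sum_congr rfl fun i _ => ?_
  rw [tsum_eq_single (f i) fun x hx => by rw [if_neg hx, zero_mul], if_pos rfl,
    PMF.uniformOfFintype_apply]

theorem tsum_map_uniformOfFintype_mul_measure {ι X Ω : Type*} [Fintype ι] [Nonempty ι]
    [MeasurableSpace Ω] {μ : Measure Ω} [IsFiniteMeasure μ] (f : ι → X) (A : X → Set Ω) :
    ∑' x, (PMF.uniformOfFintype ι).map f x * μ (A x) =
      ENNReal.ofReal (𝔼 i, μ.real (A (f i))) := by
  rw [tsum_map_uniformOfFintype_mul, Fintype.expect_eq_sum_div_card, div_eq_inv_mul,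
    ENNReal.ofReal_mul (by positivity), ENNReal.ofReal_inv_of_pos (by positivity),
    ENNReal.ofReal_natCast, ENNReal.ofReal_sum_of_nonneg fun _ _ => measureReal_nonneg]
  exact congrArg _ (Finset.sum_congr rfl fun _ _ => (ofReal_measureReal (measure_ne_top _ _)).symm)

theorem exists_mem_support_le_of_le_tsum {X : Type*} (ν : PMF X) {g : X → ℝ≥0∞} {c : ℝ≥0∞}
    (hc : c ≠ ∞) (h : c ≤ ∑' x, ν x * g x) : ∃ x ∈ ν.support, c ≤ g x := by
  by_contra! hlt
  obtain ⟨x₀, hx₀⟩ := ν.support_nonempty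
  have hsum : ∑' x, ν x * c = c := by rw [ENNReal.tsum_mul_right, ν.tsum_coe, one_mul]
  have hle (x : X) : ν x * g x ≤ ν x * c := by
    rcases eq_or_ne (ν x) 0 with hx | hx
    · rw [hx, zero_mul, zero_mul]
    · gcongr
      exact (hlt x ((ν.mem_support_iff x).2 hx)).le
  have hlt₀ : ν x₀ * g x₀ < ν x₀ * c :=
    ENNReal.mul_lt_mul_right ((ν.mem_support_iff x₀).1 hx₀) (ν.apply_ne_top x₀) (hlt x₀ hx₀)
  have hfinite : ∑' x, ν x * g x ≠ ∞ := ((ENNReal.tsum_le_tsum hle).trans_lt (by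
    rw [hsum]
    exact hc.lt_top)).ne
  exact h.not_gt ((ENNReal.tsum_lt_tsum hfinite hle hlt₀).trans_eq hsum)

end Mixture

section TailAndMean

variable {X Ω : Type*} [MeasurableSpace Ω] {μ : Measure Ω} {c V a : ℝ}

theorem ofReal_mul_measure_le_lintegral {M : Ω → ℕ} (hM : Measurable M) (c : ℝ) :
    ENNReal.ofReal c * μ {ω | c ≤ M ω} ≤ ∫⁻ ω, (M ω : ℝ≥0∞) ∂μ := by
  have hset : {ω | c ≤ M ω} = {ω | ENNReal.ofReal c ≤ (M ω : ℝ≥0∞)} := by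
    ext ω
    rw [Set.mem_ofPred_eq, Set.mem_ofPred_eq, ← ENNReal.ofReal_natCast,
      ENNReal.ofReal_le_ofReal_iff (Nat.cast_nonneg _)]
  rw [hset]
  exact mul_meas_ge_le_lintegral ((measurable_of_countable _).comp hM) _

theorem ofReal_le_lintegral {M : Ω → ℕ} (hM : Measurable M) (hc : 0 ≤ c) (hV : V ≤ c * a)
    (h : ENNReal.ofReal a ≤ μ {ω | c ≤ M ω}) :
    ENNReal.ofReal V ≤ ∫⁻ ω, (M ω : ℝ≥0∞) ∂μ :=
  calc ENNReal.ofReal V ≤ ENNReal.ofReal c * ENNReal.ofReal a := by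
        rw [← ENNReal.ofReal_mul hc]
        exact ENNReal.ofReal_le_ofReal hV
    _ ≤ ENNReal.ofReal c * μ {ω | c ≤ M ω} := by gcongr
    _ ≤ ∫⁻ ω, (M ω : ℝ≥0∞) ∂μ := ofReal_mul_measure_le_lintegral hM c

theorem ofReal_le_tsum_lintegral {ν : PMF X} {M : X → Ω → ℕ} (hM : ∀ x, Measurable (M x))
    (hc : 0 ≤ c) (hV : V ≤ c * a)
    (h : ENNReal.ofReal a ≤ ∑' x, ν x * μ {ω | c ≤ M x ω}) :
    ENNReal.ofReal V ≤ ∑' x, ν x * ∫⁻ ω, (M x ω : ℝ≥0∞) ∂μ :=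
  calc ENNReal.ofReal V ≤ ENNReal.ofReal c * ENNReal.ofReal a := by
        rw [← ENNReal.ofReal_mul hc]
        exact ENNReal.ofReal_le_ofReal hV
    _ ≤ ENNReal.ofReal c * ∑' x, ν x * μ {ω | c ≤ M x ω} := by gcongr
    _ = ∑' x, ν x * (ENNReal.ofReal c * μ {ω | c ≤ M x ω}) := by
        rw [← ENNReal.tsum_mul_left]
        exact tsum_congr fun x => mul_left_comm _ _ _
    _ ≤ ∑' x, ν x * ∫⁻ ω, (M x ω : ℝ≥0∞) ∂μ := by
        gcongr with x
        exact ofReal_mul_measure_le_lintegral (hM x) c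

theorem tail_and_mean_bounds {ν : PMF X} {M : X → Ω → ℕ} (hM : ∀ x, Measurable (M x))
    (ha : a ≤ 1) (hc : 0 ≤ c) (hV : V ≤ c * a)
    (h : ENNReal.ofReal a ≤ ∑' x, ν x * μ {ω | c ≤ M x ω}) :
    ENNReal.ofReal a ≤ ∑' x, ν x * μ {ω | V ≤ M x ω} ∧
      ENNReal.ofReal V ≤ ∑' x, ν x * ∫⁻ ω, (M x ω : ℝ≥0∞) ∂μ ∧
      ∃ x ∈ ν.support, ENNReal.ofReal a ≤ μ {ω | V ≤ M x ω} ∧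
        ENNReal.ofReal V ≤ ∫⁻ ω, (M x ω : ℝ≥0∞) ∂μ := by
  have hVc : V ≤ c := hV.trans (mul_le_of_le_one_right hc ha)
  have htail (x : X) : μ {ω | c ≤ M x ω} ≤ μ {ω | V ≤ M x ω} :=
    measure_mono fun ω hω => hVc.trans hω
  obtain ⟨x, hx, hxa⟩ := exists_mem_support_le_of_le_tsum ν ENNReal.ofReal_ne_top h
  exact ⟨h.trans (ENNReal.tsum_le_tsum fun y => mul_right_mono (htail y)),
    ofReal_le_tsum_lintegral hM hc hV h, x, hx, hxa.trans (htail x),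
    ofReal_le_lintegral (hM x) hc hV hxa⟩

end TailAndMean

namespace Schedule

variable {k N : ℕ} [NeZero N] {α : Type*} (Q : Schedule k)

theorem card_cell : Fintype.card Q.Cell = Q.total := by
  rw [Fintype.card_sigma]
  simp only [Fintype.card_fin]
  rw [Fintype.sum_prod_type, Fin.sum_univ_eq_sum_range fun i => ∑ j, Q.len i j]
  rfl

/-- The random input that runs through the schedule `Q` with uniformly random slots, out of `N` for
each stage. -/
noncomputable def randomInput (N : ℕ) [NeZero N] (item : Q.Cell ↪ α) : PMF (Input k α) :=
  (PMF.uniformOfFintype (Fin Q.stages → Fin N)).map (Q.input item)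

variable {Q} {item : Q.Cell ↪ α}

theorem distinct_and_card_arrived_of_mem_support {x : Input k α}
    (hx : x ∈ (Q.randomInput N item).support) :
    x.Distinct ∧ #(x.arrived (Q.rounds N)) = Q.total := by
  obtain ⟨u, -, rfl⟩ := (PMF.mem_support_map_iff _ _ _).1 hx
  exact ⟨Q.distinct_input u item, Q.card_arrived_input_rounds u item⟩

theorem le_tsum_randomInput_mul {Ω U D : Type*} [MeasurableSpace Ω] {μ : Measure Ω}
    [IsProbabilityMeasure μ] {P : Protocol k α Ω U D} {s : ℕ} {δ : ℝ} (hP : P.IsMeasurable)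
    (hc : P.Correct μ s) (hK : 0 < #(Q.hardPairs s δ)) :
    ENNReal.ofReal (1 - 2 * (δ + #(Q.hardPairs s δ) / N)) ≤ ∑' x, Q.randomInput N item x *
      μ {ω | (#(Q.hardPairs s δ) / 2 : ℝ) ≤ P.messages ω x (Q.rounds N)} := by
  rw [randomInput, tsum_map_uniformOfFintype_mul_measure]
  exact ENNReal.ofReal_le_ofReal (le_expect_half_le_messages hP hc item hK)

end Schedule

end DistributedSampling

open MeasureTheory DistributedSampling in
theorem theorem3 (q : ℝ) (hq0 : 0 < q) (hq1 : q < 1) :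
    ∃ C : ℝ, 0 < C ∧
      ∀ (k s n : ℕ) (α : Type*), 1 ≤ k → 1 ≤ s → k ≤ n → Nonempty (Fin n ↪ α) →
        -- a distribution on inputs with `n` elements, which does not depend on the protocol
        ∃ (T : ℕ) (ν : PMF (Input k α)),
          (∀ x ∈ ν.support, x.Distinct ∧ (x.arrived T).card = n) ∧
          ∀ (Ω U D : Type*) [MeasurableSpace Ω] (μ : Measure Ω) [IsProbabilityMeasure μ]
            (P : Protocol k α Ω U D), P.IsMeasurable → P.Correct μ s →
            -- on the random input
            ENNReal.ofReal (1 - q) ≤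
              ∑' x, ν x * μ {ω | C * bound k s n ≤ (P.messages ω x T : ℝ)} ∧
            ENNReal.ofReal (C * bound k s n) ≤
              ∑' x, ν x * ∫⁻ ω, (P.messages ω x T : ENNReal) ∂μ ∧
            -- on a fixed input, over the internal randomness of the protocol alone
            ∃ x ∈ ν.support,
              ENNReal.ofReal (1 - q) ≤ μ {ω | C * bound k s n ≤ (P.messages ω x T : ℝ)} ∧
              ENNReal.ofReal (C * bound k s n) ≤ ∫⁻ ω, (P.messages ω x T : ENNReal) ∂μ := by
  obtain ⟨A, hA⟩ := exists_nat_ge (4 / q)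
  have hδ : 1 ≤ q / 4 * (A + 1) := by
    rw [div_le_iff₀ hq0] at hA
    linarith
  refine ⟨(1 - q) / (4 * (A + 1) ^ 2), div_pos (sub_pos.2 hq1) (by positivity), ?_⟩
  intro k s n α hk hs hkn ⟨f⟩
  obtain ⟨Q, rfl, hK, hbound⟩ := exists_schedule hδ hk hs hkn
  set K := (Q.hardPairs s (q / 4)).card
  obtain ⟨N, hN⟩ := exists_nat_ge (K / (q / 4))
  have hslots : 1 - q ≤ 1 - 2 * (q / 4 + K / (N + 1 : ℕ)) := by
    have : (K : ℝ) / (N + 1 : ℕ) ≤ q / 4 := by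
      rw [div_le_comm₀ (by positivity) (by positivity)]
      push_cast
      linarith
    linarith
  have hV : (1 - q) / (4 * (A + 1) ^ 2) * bound k s Q.total ≤ K / 2 * (1 - q) := by
    rw [div_mul_eq_mul_div, div_le_iff₀ (by positivity)]
    nlinarith
  let item : Q.Cell ↪ α := (Fintype.equivFinOfCardEq Q.card_cell).toEmbedding.trans f
  refine ⟨Q.rounds (N + 1), Q.randomInput (N + 1) item,
    fun x hx => Schedule.distinct_and_card_arrived_of_mem_support hx, ?_⟩
  intro Ω U D _ μ _ P hP hc
  exact tail_and_mean_bounds (fun x => hP.messages x _) (by linarith) (by positivity) hV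
    ((ENNReal.ofReal_le_ofReal hslots).trans (Schedule.le_tsum_randomInput_mul hP hc hK))
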